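/- Let $A$ be a right Noetherian ring and let $e,f\in A$ be idempotents. For a right Noetherian ring $R$ let $\operatorname{mod}R$ be the abelian category of finitely generated right $R$-modules and $D^b(\operatorname{mod}R)$ its bounded derived category; then $eAe$ is again right Noetherian, and $\mathbb{F}=\operatorname{Hom}_A(eA,-)$ is an exact functor $\operatorname{mod}A\to\operatorname{mod}eAe$, which therefore induces a triangulated functor $D^b(\operatorname{mod}A)\to D^b(\operatorname{mod}eAe)$. For a class $\mathcal S$ of objects of a triangulated category let $\operatorname{thick}(\mathcal S)$ be the smallest triangulated subcategory that contains $\mathcal S$ and is closed under direct summands; quotients of triangulated categories are Verdier quotients, and modules are regarded as complexes concentrated in degree $0$. Let $q\colon D^b(\operatorname{mod}A)\to D^b(\operatorname{mod}A)/\operatorname{thick}(fA)$ be the quotient functor, and regard $\operatorname{mod}A/AeA$ as a subcategory of $\operatorname{mod}A$ by restriction of scalars along $A\to A/AeA$. Then $\mathbb{F}$ induces an equivalence of triangulated categories $$\frac{D^b(\operatorname{mod}A)/\operatorname{thick}(fA)}{\operatorname{thick}\bigl(q(\operatorname{mod}A/AeA)\bigr)}\;\longrightarrow\;\frac{D^b(\operatorname{mod}eAe)}{\operatorname{thick}(fAe)},$$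 that is, there is a triangulated functor between these quotients which is an equivalence of categories and whose composite with the quotient functors from $D^b(\operatorname{mod}A)$ is isomorphic, compatibly with the shifts, to the composite of $D^b(\operatorname{mod}A)\to D^b(\operatorname{mod}eAe)$ with the quotient functor $D^b(\operatorname{mod}eAe)\to D^b(\operatorname{mod}eAe)/\operatorname{thick}(fAe)$. -/

import Mathlib

open CategoryTheory CategoryTheory.Limits MulOpposite

universe w₁ w₂ u

noncomputable section

namespace TwoIdempotents

/-! ### Triangulated generalities -/

section Verdier

variable {C : Type*} [Category C] [HasZeroObject C] [HasShift C ℤ] [Preadditive C]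
  [∀ n : ℤ, (shiftFunctor C n).Additive] [Pretriangulated C]

/-- `thick P`: the smallest triangulated subcategory that contains all objects satisfying `P` and is
closed under direct summands (see `thick_le_iff`). -/
abbrev thick (P : ObjectProperty C) : ObjectProperty C := P.triangEnvelope

/-- The Verdier quotient `C / P` by (the full triangulated subcategory given by) `P`: the
localization of `C` at the morphisms whose cone satisfies `P`, with its induced triangulation. -/
def VerdierQuotient (P : ObjectProperty C) : Type _ := P.trW.Localization

instance (P : ObjectProperty C) : Category (VerdierQuotient P) :=
  inferInstanceAs (Category P.trW.Localization)

/-- The quotient functor `C ⥤ C / P`. -/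
def verdierQ (P : ObjectProperty C) : C ⥤ VerdierQuotient P := P.trW.Q

instance (P : ObjectProperty C) : (verdierQ P).IsLocalization P.trW :=
  inferInstanceAs (P.trW.Q.IsLocalization P.trW)

section

variable [IsTriangulated C] (P : ObjectProperty C) [P.IsTriangulated]

instance : HasShift (VerdierQuotient P) ℤ := inferInstanceAs (HasShift P.trW.Localization ℤ)

instance : (verdierQ P).CommShift ℤ := inferInstanceAs (P.trW.Q.CommShift ℤ)

instance : Preadditive (VerdierQuotient P) := inferInstanceAs (Preadditive P.trW.Localization)

instance : (verdierQ P).Additive := inferInstanceAs P.trW.Q.Additive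

instance : HasZeroObject (VerdierQuotient P) := inferInstanceAs (HasZeroObject P.trW.Localization)

instance (n : ℤ) : (shiftFunctor (VerdierQuotient P) n).Additive :=
  inferInstanceAs (shiftFunctor P.trW.Localization n).Additive

instance : Pretriangulated (VerdierQuotient P) :=
  inferInstanceAs (Pretriangulated P.trW.Localization)

instance : IsTriangulated (VerdierQuotient P) :=
  inferInstanceAs (IsTriangulated P.trW.Localization)

instance : (verdierQ P).IsTriangulated := inferInstanceAs P.trW.Q.IsTriangulated

end

lemma le_thick (P : ObjectProperty C) : P ≤ thick P := P.le_triangEnvelope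

lemma thick_le_iff (P Q : ObjectProperty C) [Q.IsStableUnderRetracts] [Q.IsTriangulated] :
    thick P ≤ Q ↔ P ≤ Q := P.triangEnvelope_le_iff

end Verdier

/-! ### Bounded derived categories -/

section Bounded

variable {C : Type*} [Category C] [Abelian C] [HasDerivedCategory.{w₁} C]
  {D : Type*} [Category D] [Abelian D] [HasDerivedCategory.{w₂} D]

/-- An object of an abelian category as a complex concentrated in degree `0`. -/
abbrev stalk : C ⥤ DerivedCategory.Bounded C :=
  DerivedCategory.TStructure.t.bounded.lift (DerivedCategory.singleFunctor C 0)
    fun _ => ⟨⟨0, inferInstance⟩, ⟨0, inferInstance⟩⟩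

variable (F : C ⥤ D) [F.Additive] [PreservesFiniteLimits F] [PreservesFiniteColimits F]

lemma bounded_mapDerivedCategory (X : DerivedCategory.Bounded C) :
    DerivedCategory.TStructure.t.bounded (F.mapDerivedCategory.obj X.obj) := by
  obtain ⟨X, ⟨a, ⟨⟨K, eK, hK⟩⟩⟩, ⟨b, ⟨⟨L, eL, hL⟩⟩⟩⟩ := X
  refine ⟨⟨a, ⟨⟨(F.mapHomologicalComplex (ComplexShape.up ℤ)).obj K,
    F.mapDerivedCategory.mapIso eK ≪≫ F.mapDerivedCategoryFactors.app K, ⟨fun i hi => ?_⟩⟩⟩⟩,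
    ⟨b, ⟨⟨(F.mapHomologicalComplex (ComplexShape.up ℤ)).obj L,
    F.mapDerivedCategory.mapIso eL ≪≫ F.mapDerivedCategoryFactors.app L, ⟨fun i hi => ?_⟩⟩⟩⟩⟩
  · exact F.map_isZero (hK.isZero i hi)
  · exact F.map_isZero (hL.isZero i hi)

/-- The functor `Dᵇ(C) ⥤ Dᵇ(D)` induced by an exact functor `F : C ⥤ D`, i.e. termwise
application of `F` to complexes. -/
abbrev boundedMap : DerivedCategory.Bounded C ⥤ DerivedCategory.Bounded D :=
  DerivedCategory.TStructure.t.bounded.lift (DerivedCategory.Bounded.ι ⋙ F.mapDerivedCategory)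
    (bounded_mapDerivedCategory F)

end Bounded

/-! ### Right modules and idempotents -/

section Modules

variable {A : Type u} [Ring A] {e f : A}

variable (e) in
/-- The right ideal `eA` of `A`; right `A`-modules are modules over `Aᵐᵒᵖ`. -/
def rightIdeal : Submodule Aᵐᵒᵖ A where
  carrier := {x | ∃ a, e * a = x}
  add_mem' := by rintro _ _ ⟨a, rfl⟩ ⟨b, rfl⟩; exact ⟨a + b, mul_add _ _ _⟩
  zero_mem' := ⟨0, mul_zero _⟩
  smul_mem' := by rintro r _ ⟨a, rfl⟩; exact ⟨a * r.unop, (mul_assoc _ _ _).symm⟩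

/-- Left multiplication `eA → eA` by an element of the corner ring `eAe`. -/
def cornerMul (he : IsIdempotentElem e) (r : he.Corner) :
    rightIdeal e →ₗ[Aᵐᵒᵖ] rightIdeal e where
  toFun x := ⟨r.1 * x.1, r.1 * x.1, by
    rw [← mul_assoc, ((Subsemigroup.mem_corner_iff he).1 r.2).1]⟩
  map_add' x y := Subtype.ext (mul_add _ _ _)
  map_smul' a x := Subtype.ext (mul_assoc _ _ _).symm

/-- The abelian group `Hom_A(eA, M)` of a right `A`-module `M`. -/
def CornerHom (_ : IsIdempotentElem e) (M : Type*) [AddCommGroup M] [Module Aᵐᵒᵖ M] : Type _ :=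
  rightIdeal e →ₗ[Aᵐᵒᵖ] M

section

variable (he : IsIdempotentElem e) (M : Type*) [AddCommGroup M] [Module Aᵐᵒᵖ M]

instance : AddCommGroup (CornerHom he M) :=
  inferInstanceAs (AddCommGroup (rightIdeal e →ₗ[Aᵐᵒᵖ] M))


lemma cornerMul_one : cornerMul he 1 = LinearMap.id := by
  ext ⟨_, a, rfl⟩
  change e * (e * a) = e * a
  rw [← mul_assoc, he.eq]

lemma cornerMul_mul (r s : he.Corner) :
    cornerMul he (r * s) = (cornerMul he r).comp (cornerMul he s) :=
  LinearMap.ext fun x => Subtype.ext (mul_assoc r.1 s.1 x.1)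

lemma cornerMul_add (r s : he.Corner) :
    cornerMul he (r + s) = cornerMul he r + cornerMul he s :=
  LinearMap.ext fun x => Subtype.ext (add_mul r.1 s.1 x.1)

lemma cornerMul_zero : cornerMul he 0 = 0 :=
  LinearMap.ext fun x => Subtype.ext (zero_mul x.1)

variable {M} in
/-- An element of `Hom_A(eA, M)` as a linear map. -/
def CornerHom.toHom (φ : CornerHom he M) : rightIdeal e →ₗ[Aᵐᵒᵖ] M := φ

/-- The right `eAe`-module structure on `Hom_A(eA, M)`: `(φ · r)(x) = φ (r x)`. -/
instance : Module he.Cornerᵐᵒᵖ (CornerHom he M) where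
  smul r φ := (CornerHom.toHom he φ).comp (cornerMul he r.unop)
  one_smul φ := by
    change (CornerHom.toHom he φ).comp (cornerMul he 1) = CornerHom.toHom he φ
    rw [cornerMul_one, LinearMap.comp_id]
  mul_smul r s φ := by
    change (CornerHom.toHom he φ).comp (cornerMul he (s.unop * r.unop)) = _
    rw [cornerMul_mul]
    rfl
  smul_zero r := LinearMap.zero_comp _
  smul_add r φ ψ := LinearMap.add_comp _ _ _
  add_smul r s φ := by
    change (CornerHom.toHom he φ).comp (cornerMul he (r.unop + s.unop)) = _
    rw [cornerMul_add, LinearMap.comp_add]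
    rfl
  zero_smul φ := by
    change (CornerHom.toHom he φ).comp (cornerMul he 0) = _
    rw [cornerMul_zero, LinearMap.comp_zero]
    rfl

lemma CornerHom.smul_toHom_apply (r : he.Cornerᵐᵒᵖ) (φ : CornerHom he M) (x : rightIdeal e) :
    (CornerHom.toHom he (r • φ)) x = (CornerHom.toHom he φ) (cornerMul he r.unop x) := rfl

variable (e) in
/-- The element `e` of `eA`. -/
def gen : rightIdeal e := ⟨e, 1, mul_one e⟩

lemma CornerHom.toHom_apply (φ : CornerHom he M) (x : rightIdeal e) :
    CornerHom.toHom he φ x = op x.1 • CornerHom.toHom he φ (gen e) := by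
  rw [← map_smul]
  congr 1
  obtain ⟨_, a, rfl⟩ := x
  exact Subtype.ext (show e * a = e * (e * a) by rw [← mul_assoc, he.eq])

variable {M} in
lemma CornerHom.ext_gen {φ ψ : CornerHom he M}
    (h : CornerHom.toHom he φ (gen e) = CornerHom.toHom he ψ (gen e)) : φ = ψ :=
  LinearMap.ext fun x => (CornerHom.toHom_apply he M φ x).trans
    (Eq.trans (by rw [h]) (CornerHom.toHom_apply he M ψ x).symm)

variable {M} in
/-- The homomorphism `eA → M`, `x ↦ m x`. -/
def CornerHom.ofElem (m : M) : CornerHom he M :=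
  ((LinearMap.toSpanSingleton Aᵐᵒᵖ M m).comp
    ({ toFun := op, map_add' := fun _ _ => rfl, map_smul' := fun _ _ => rfl } :
      A →ₗ[Aᵐᵒᵖ] Aᵐᵒᵖ)).comp (rightIdeal e).subtype

variable {M} in
lemma CornerHom.ofElem_apply (m : M) (x : rightIdeal e) :
    CornerHom.toHom he (CornerHom.ofElem he m) x = op x.1 • m := rfl

instance [IsNoetherian Aᵐᵒᵖ M] : IsNoetherian he.Cornerᵐᵒᵖ (CornerHom he M) := by
  rw [isNoetherian_iff']
  let E (N : Submodule he.Cornerᵐᵒᵖ (CornerHom he M)) : Submodule Aᵐᵒᵖ M :=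
    Submodule.span Aᵐᵒᵖ ((fun φ : CornerHom he M => CornerHom.toHom he φ (gen e)) '' N)
  have hE : Monotone E := fun N N' h => Submodule.span_mono (Set.image_mono h)
  have key (N) (m : M) (hm : m ∈ E N) :
      ∀ a : Aᵐᵒᵖ, ∃ ψ ∈ N, CornerHom.toHom he ψ (gen e) = op e • a • m := by
    induction hm using Submodule.span_induction with
    | mem m hm =>
      obtain ⟨φ, hφ, rfl⟩ := hm
      intro a
      let r : he.Corner := ⟨e * a.unop * e, a.unop, rfl⟩
      refine ⟨op r • φ, N.smul_mem _ hφ, ?_⟩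
      rw [CornerHom.smul_toHom_apply, ← map_smul, ← map_smul]
      congr 1
      exact Subtype.ext (show e * a.unop * e * e = e * a.unop * e by rw [mul_assoc, he.eq])
    | zero => exact fun a => ⟨0, N.zero_mem, by rw [smul_zero, smul_zero]; rfl⟩
    | add x y _ _ hx hy =>
      intro a
      obtain ⟨φ, hφ, h⟩ := hx a
      obtain ⟨ψ, hψ, h'⟩ := hy a
      exact ⟨φ + ψ, N.add_mem hφ hψ, by rw [smul_add, smul_add, ← h, ← h']; rfl⟩
    | smul b x _ hx =>
      intro a
      rw [smul_smul a b]
      exact hx _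
  have le (N N') (h : E N ≤ E N') : N ≤ N' := by
    intro φ hφ
    obtain ⟨ψ, hψ, h⟩ := key N' _ (h (Submodule.subset_span ⟨φ, hφ, rfl⟩)) 1
    rw [one_smul, ← map_smul] at h
    have : ψ = φ := CornerHom.ext_gen he (h.trans (congrArg _ (Subtype.ext he.eq)))
    exact this ▸ hψ
  have inj : Function.Injective E := fun N N' h => le_antisymm (le _ _ h.le) (le _ _ h.ge)
  exact (hE.strictMono_of_injective inj).wellFoundedGT

variable (e f) in
/-- The abelian group `fAe`. -/
def biCorner : AddSubgroup A where
  carrier := {x | ∃ a, f * a * e = x}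
  add_mem' := by rintro _ _ ⟨a, rfl⟩ ⟨b, rfl⟩; exact ⟨a + b, by rw [mul_add, add_mul]⟩
  zero_mem' := ⟨0, by rw [mul_zero, zero_mul]⟩
  neg_mem' := by rintro _ ⟨a, rfl⟩; exact ⟨-a, by rw [mul_neg, neg_mul]⟩

variable (f) in
/-- The abelian group `fAe`, considered as a right module over `eAe`. -/
def BiCorner (_ : IsIdempotentElem e) : Type u := biCorner e f

instance : AddCommGroup (BiCorner f he) := inferInstanceAs (AddCommGroup (biCorner e f))

/-- The right `eAe`-module structure on `fAe`, given by multiplication in `A`. -/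
instance : Module he.Cornerᵐᵒᵖ (BiCorner f he) where
  smul r x := ⟨x.1 * r.unop.1, by
    obtain ⟨_, a, rfl⟩ := x
    obtain ⟨b, hb⟩ := r.unop.2
    exact ⟨a * e * e * b, by rw [← hb]; simp only [mul_assoc]⟩⟩
  one_smul := by
    rintro ⟨_, a, rfl⟩
    exact Subtype.ext (show f * a * e * e = f * a * e by rw [mul_assoc, he.eq])
  mul_smul r s x := Subtype.ext (mul_assoc x.1 s.unop.1 r.unop.1).symm
  smul_zero r := Subtype.ext (zero_mul r.unop.1)
  smul_add r x y := Subtype.ext (add_mul x.1 y.1 r.unop.1)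
  add_smul r s x := Subtype.ext (mul_add x.1 r.unop.1 s.unop.1)
  zero_smul x := Subtype.ext (mul_zero x.1)

end


variable [IsNoetherianRing Aᵐᵒᵖ] (he : IsIdempotentElem e)

instance isNoetherian_right : IsNoetherian Aᵐᵒᵖ A :=
  isNoetherian_of_linearEquiv
    ({ opAddEquiv.symm with map_smul' := fun _ _ => rfl } : Aᵐᵒᵖ ≃ₗ[Aᵐᵒᵖ] A)

instance : IsNoetherian he.Cornerᵐᵒᵖ (BiCorner f he) :=
  isNoetherian_of_injective
    ({ toFun := fun x => CornerHom.ofElem he x.1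
       map_add' := fun x y => LinearMap.ext fun z => add_mul x.1 y.1 z.1
       map_smul' := fun r x => LinearMap.ext fun z => mul_assoc x.1 r.unop.1 z.1 } :
      BiCorner f he →ₗ[he.Cornerᵐᵒᵖ] CornerHom he A) <| by
    rintro ⟨_, a, rfl⟩ ⟨_, b, rfl⟩ h
    have h' : f * a * e * e = f * b * e * e := LinearMap.congr_fun
      (show CornerHom.toHom he _ = CornerHom.toHom he _ from h) (gen e)
    rw [mul_assoc, mul_assoc _ e e, he.eq] at h'
    exact Subtype.ext h'

/-- If `A` is right Noetherian, then so is `eAe`. -/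
instance isNoetherianRing_corner : IsNoetherianRing he.Cornerᵐᵒᵖ :=
  isNoetherian_of_injective
    ({ toFun := fun r => ⟨r.unop.1, r.unop.2⟩
       map_add' := fun _ _ => rfl
       map_smul' := fun _ _ => rfl } : he.Cornerᵐᵒᵖ →ₗ[he.Cornerᵐᵒᵖ] BiCorner e he)
    fun _ _ h => unop_injective (Subtype.ext (congrArg Subtype.val h))

/-- The functor `Hom_A(eA, -)` from finitely generated right `A`-modules to finitely generated right
`eAe`-modules. -/
def homFunctor : FGModuleCat.{u} Aᵐᵒᵖ ⥤ FGModuleCat.{u} he.Cornerᵐᵒᵖ where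
  obj M := FGModuleCat.of he.Cornerᵐᵒᵖ (CornerHom he M)
  map {M N} g := FGModuleCat.ofHom
    { toFun := fun φ => LinearMap.comp g.hom.hom (CornerHom.toHom he φ)
      map_add' := fun φ ψ => LinearMap.comp_add _ _ _
      map_smul' := fun _ _ => rfl }

lemma homFunctor_map_apply {M N : FGModuleCat.{u} Aᵐᵒᵖ} (g : M ⟶ N) (φ : CornerHom he M)
    (x : rightIdeal e) :
    CornerHom.toHom he (((homFunctor he).map g).hom.hom φ) x =
      g.hom.hom (CornerHom.toHom he φ x) := rfl

instance : (homFunctor he).Additive where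
  map_add := by
    intro M N g h
    ext φ
    rfl

lemma homFunctor_shortExact (S : ShortComplex (FGModuleCat.{u} Aᵐᵒᵖ)) (hS : S.ShortExact) :
    (S.map (homFunctor he)).ShortExact := by
  let U := forget₂ (FGModuleCat.{u} Aᵐᵒᵖ) (ModuleCat.{u} Aᵐᵒᵖ)
  let V := forget₂ (FGModuleCat.{u} he.Cornerᵐᵒᵖ) (ModuleCat.{u} he.Cornerᵐᵒᵖ)
  have hU : (S.map U).ShortExact := hS.map_of_exact U
  have inj := hU.moduleCat_injective_f
  have surj := hU.moduleCat_surjective_g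
  have ex := (ShortComplex.ShortExact.moduleCat_exact_iff_function_exact _).1 hU.exact
  have g_smul (a : A) (m : S.X₂) : S.g.hom.hom (op a • m) = op a • S.g.hom.hom m := map_smul _ _ _
  have f_smul (a : A) (m : S.X₁) : S.f.hom.hom (op a • m) = op a • S.f.hom.hom m := map_smul _ _ _
  have gen_smul {M : FGModuleCat.{u} Aᵐᵒᵖ} (φ : CornerHom he M) :
      op e • CornerHom.toHom he φ (gen e) = CornerHom.toHom he φ (gen e) :=
    (CornerHom.toHom_apply he M φ (gen e)).symm
  have : Mono (S.map (homFunctor he)).f := V.mono_of_mono_map <|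
    (ModuleCat.mono_iff_injective _).2 fun φ ψ h => LinearMap.ext fun x =>
      inj (LinearMap.congr_fun (show (_ : rightIdeal e →ₗ[Aᵐᵒᵖ] S.X₂) = _ from h) x)
  have : Epi (S.map (homFunctor he)).g := V.epi_of_epi_map <|
    (ModuleCat.epi_iff_surjective _).2 fun φ => by
      obtain ⟨m, hm⟩ := surj (CornerHom.toHom he φ (gen e))
      exact ⟨CornerHom.ofElem he (M := S.X₂) m, CornerHom.ext_gen he <|
        (g_smul e m).trans ((congrArg _ hm).trans (gen_smul φ))⟩
  refine ⟨?_⟩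
  rw [← ShortComplex.exact_map_iff_of_faithful _ V,
    ShortComplex.ShortExact.moduleCat_exact_iff_function_exact]
  intro φ
  constructor
  · intro h
    obtain ⟨m, hm⟩ := (ex (CornerHom.toHom he φ (gen e))).1 (LinearMap.congr_fun
      (show CornerHom.toHom he _ = CornerHom.toHom he _ from h) (gen e))
    exact ⟨CornerHom.ofElem he (M := S.X₁) m, CornerHom.ext_gen he <|
      (f_smul e m).trans ((congrArg _ hm).trans (gen_smul φ))⟩
  · rintro ⟨ψ, rfl⟩
    exact LinearMap.ext fun x => (ex _).2 ⟨_, rfl⟩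

instance : PreservesFiniteLimits (homFunctor he) :=
  (((homFunctor he).exact_tfae.out 0 3 rfl rfl).1 (homFunctor_shortExact he)).1

instance : PreservesFiniteColimits (homFunctor he) :=
  (((homFunctor he).exact_tfae.out 0 3 rfl rfl).1 (homFunctor_shortExact he)).2

variable (e) in
/-- The quotient ring `A / AeA`. -/
abbrev QuotientRing : Type u := (TwoSidedIdeal.span {e}).ringCon.Quotient

variable (e) in
/-- The projection `A → A / AeA`. -/
abbrev quotientMap : A →+* QuotientRing e := (TwoSidedIdeal.span {e}).ringCon.mk'

variable (e) in
/-- The essential image of `mod A/AeA` in `mod A` under restriction of scalars along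
`A → A / AeA`. -/
def modQuotient : ObjectProperty (FGModuleCat.{u} Aᵐᵒᵖ) := fun M =>
  ∃ N : FGModuleCat.{u} (QuotientRing e)ᵐᵒᵖ,
    Nonempty ((ModuleCat.restrictScalars (quotientMap e).op).obj N.obj ≅ M.obj)

instance : (modQuotient e).Nonempty :=
  let N : FGModuleCat.{u} (QuotientRing e)ᵐᵒᵖ := FGModuleCat.of _ PUnit.{u + 1}
  have : Module.Finite Aᵐᵒᵖ ((ModuleCat.restrictScalars (quotientMap e).op).obj N.obj) :=
    inferInstanceAs (Module.Finite Aᵐᵒᵖ PUnit.{u + 1})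
  ⟨⟨_, this⟩, N, ⟨Iso.refl _⟩⟩

section Statement

variable (f)
variable [HasDerivedCategory.{w₁} (FGModuleCat.{u} Aᵐᵒᵖ)]
  [HasDerivedCategory.{w₂} (FGModuleCat.{u} he.Cornerᵐᵒᵖ)]

variable (A) in
/-- The bounded derived category `Dᵇ(mod A)` of finitely generated right `A`-modules. -/
abbrev Db : Type _ := DerivedCategory.Bounded (FGModuleCat.{u} Aᵐᵒᵖ)

/-- `thick(fA)` in `Dᵇ(mod A)`. -/
abbrev thickRightIdeal : ObjectProperty (Db A) :=
  thick (.singleton (stalk.obj (FGModuleCat.of Aᵐᵒᵖ (rightIdeal f))))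

/-- `thick(fAe)` in `Dᵇ(mod eAe)`. -/
abbrev thickBiCorner : ObjectProperty (Db he.Corner) :=
  thick (.singleton (stalk.obj (FGModuleCat.of he.Cornerᵐᵒᵖ (BiCorner f he))))

variable (e) in
/-- `thick(q(mod A/AeA))` in `Dᵇ(mod A) / thick(fA)`, where `q` is the quotient functor. -/
abbrev thickModQuotient : ObjectProperty (VerdierQuotient (thickRightIdeal (A := A) f)) :=
  thick ((modQuotient e).map (stalk ⋙ verdierQ (thickRightIdeal f)))

end Statement

end Modules

end TwoIdempotents

end

noncomputable section

/-! The functor `Hom_A(eA, -)` is exact and has the left adjoint `- ⊗_{eAe} eA`, whose unit is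
invertible. This already makes the induced functor `T` on bounded derived categories a Verdier
quotient (`boundedMap_isLocalization`). No derived tensor product is needed: the left adjoint is
applied termwise to complexes chosen as representatives, and applying `Hom_A(eA, -)` afterwards
gives these complexes back, so objects and roofs in the target lift to the source.

The kernel of `T` is generated as a thick subcategory by the modules `M` with `Hom_A(eA, M) = 0`
(`kernel_boundedMap_le_thick`). Since `Hom_A(eA, M)` is `Me`, these are the modules over `A/AeA`
(`kernel_homFunctor`).

Moreover `T` sends `fA` to `fAe`. Hence both sides of the theorem arise from `Dᵇ(mod A)` by killing
`fA` and `mod A/AeA`, in the two possible orders. The universal properties yield mutually inverse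
functors (`exists_equivalence_verdierQuotient`). -/

namespace TwoIdempotents

/-! ### Kernels of triangulated functors. -/

section Kernel

open Pretriangulated ZeroObject

variable {C : Type*} [Category C] [HasZeroObject C] [HasShift C ℤ] [Preadditive C]
  [∀ n : ℤ, (shiftFunctor C n).Additive] [Pretriangulated C]
  {D : Type*} [Category D] [HasZeroObject D] [HasShift D ℤ] [Preadditive D]
  [∀ n : ℤ, (shiftFunctor D n).Additive] [Pretriangulated D]
  (T : C ⥤ D) [T.CommShift ℤ] [T.IsTriangulated]

instance kernel_isTriangulated : T.kernel.IsTriangulated where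
  exists_zero := ⟨0, isZero_zero C, T.map_isZero (isZero_zero C)⟩
  isStableUnderShiftBy n :=
    { le_shift := fun X hX => ((T.commShiftIso n).app X).isZero_iff.2
        ((shiftFunctor D n).map_isZero hX) }
  ext₂' X hX h₁ h₃ := T.kernel.le_isoClosure _
    (Triangle.isZero₂_of_isZero₁₃ _ (T.map_distinguished X hX) h₁ h₃)

instance kernel_isStableUnderRetracts : T.kernel.IsStableUnderRetracts where
  of_retract r hY := by
    change IsZero _ at hY ⊢
    rw [IsZero.iff_id_eq_zero] at hY ⊢
    rw [← T.map_id, ← r.retract, T.map_comp, ← Category.id_comp (T.map r.r), hY]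
    simp

lemma kernel_trW_iff {X Y : C} (f : X ⟶ Y) : T.kernel.trW f ↔ IsIso (T.map f) := by
  obtain ⟨Z, g, h, hT⟩ := distinguished_cocone_triangle f
  exact (T.kernel.trW_iff_of_distinguished _ hT).trans
    (Triangle.isZero₃_iff_isIso₁ _ (T.map_distinguished _ hT))

variable {T} in
lemma isInvertedBy_trW {P : ObjectProperty C} (h : P ≤ T.kernel) : P.trW.IsInvertedBy T :=
  fun _ _ f hf => (kernel_trW_iff T f).1 (ObjectProperty.trW_monotone h _ hf)

/-- A full triangulated functor that reflects zero objects is faithful. -/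
lemma faithful_of_full_of_kernel [T.Full] (hT : ∀ X, IsZero (T.obj X) → IsZero X) :
    T.Faithful := by
  have refl {X Y : C} (f : X ⟶ Y) (hf : IsIso (T.map f)) : IsIso f := by
    obtain ⟨Z, g, h, hd⟩ := distinguished_cocone_triangle f
    rw [← kernel_trW_iff] at hf
    exact (Triangle.isZero₃_iff_isIso₁ _ hd).1
      (hT _ ((T.kernel.trW_iff_of_distinguished _ hd).1 hf))
  suffices ∀ {X Y : C} (f : X ⟶ Y), T.map f = 0 → f = 0 from
    ⟨fun {X Y f g} h => sub_eq_zero.1 (this _ (by rw [T.map_sub, h, sub_self]))⟩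
  intro X Y f hf
  obtain ⟨Z, g, h, hd⟩ := distinguished_cocone_triangle f
  -- As `T.map f = 0`, the identity of `T.obj Y` factors through `T.map g`. Fullness lifts the
  -- retraction to `r`, and `g ≫ r` is an isomorphism that `f` composes to zero with.
  obtain ⟨r, hr⟩ := Triangle.yoneda_exact₂ _ (T.map_distinguished _ hd) (𝟙 (T.obj Y))
    (show T.map f ≫ _ = 0 by rw [hf, zero_comp])
  obtain ⟨r : Z ⟶ Y, rfl⟩ := T.map_surjective r
  have hr : 𝟙 (T.obj Y) = T.map g ≫ T.map r := hr
  have : IsIso (g ≫ r) := refl _ (by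
    rw [T.map_comp, ← hr]
    infer_instance)
  have h0 : f ≫ g = 0 := comp_distTriang_mor_zero₁₂ _ hd
  have h0 : f ≫ g ≫ r = 0 := by rw [← Category.assoc, h0, zero_comp]
  rw [← cancel_mono (g ≫ r), h0, zero_comp]

end Kernel

/-! ### Universal property of Verdier quotients. -/

section Lift

open Pretriangulated ZeroObject

variable {C : Type*} [Category C] [HasZeroObject C] [HasShift C ℤ] [Preadditive C]
  [∀ n : ℤ, (shiftFunctor C n).Additive] [Pretriangulated C]
  {D : Type*} [Category D] [HasZeroObject D] [HasShift D ℤ] [Preadditive D]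
  [∀ n : ℤ, (shiftFunctor D n).Additive] [Pretriangulated D]
  {E : Type*} [Category E] [HasZeroObject E] [HasShift E ℤ] [Preadditive E]
  [∀ n : ℤ, (shiftFunctor E n).Additive] [Pretriangulated E]

/-- A triangulated functor factors through every triangulated localization that it inverts, by a
triangulated functor. -/
lemma exists_triangulated_lift (L : C ⥤ D) [L.CommShift ℤ] [L.IsTriangulated]
    (W : MorphismProperty C) [L.IsLocalization W] [W.HasLeftCalculusOfFractions]
    (T : C ⥤ E) [T.CommShift ℤ] [T.IsTriangulated] (hT : W.IsInvertedBy T) :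
    ∃ (Φ : D ⥤ E) (_ : Φ.CommShift ℤ) (_ : Φ.IsTriangulated) (α : L ⋙ Φ ≅ T),
      NatTrans.CommShift α.hom ℤ := by
  let Φ := Localization.lift T hT L
  let _ : Φ.CommShift ℤ := Functor.commShiftOfLocalization L W ℤ T Φ
  have hα : NatTrans.CommShift (Localization.Lifting.iso L W T Φ).hom ℤ := inferInstance
  have := Localization.essSurj_mapArrow L W
  exact ⟨Φ, inferInstance, Functor.isTriangulated_of_precomp_iso (Localization.Lifting.iso L W T Φ),
    Localization.Lifting.iso L W T Φ, hα⟩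

variable [IsTriangulated C]

lemma exists_lift_verdierQ (P : ObjectProperty C) [P.IsTriangulated]
    (T : C ⥤ E) [T.CommShift ℤ] [T.IsTriangulated] (hT : P ≤ T.kernel) :
    ∃ (Φ : VerdierQuotient P ⥤ E) (_ : Φ.CommShift ℤ) (_ : Φ.IsTriangulated)
      (α : verdierQ P ⋙ Φ ≅ T), NatTrans.CommShift α.hom ℤ :=
  exists_triangulated_lift (verdierQ P) P.trW T (isInvertedBy_trW hT)

/-- The cone of `0 ⟶ X` is `X`, so the quotient functor inverts this morphism when `X` lies in `P`.
-/
lemma le_kernel_verdierQ (P : ObjectProperty C) [P.IsTriangulated] :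
    P ≤ (verdierQ P).kernel := fun X hX =>
  have : IsIso ((verdierQ P).map (0 : 0 ⟶ X)) := Localization.inverts _ P.trW _
    ⟨_, _, _, contractible_distinguished₁ X, hX⟩
  (asIso ((verdierQ P).map (0 : 0 ⟶ X))).isZero_iff.1 ((verdierQ P).map_isZero (isZero_zero C))

/-- A triangulated functor is a localization at its kernel if it is essentially surjective and if
every morphism between objects in its image is a right fraction. -/
lemma isLocalization_kernel (T : C ⥤ E) [T.CommShift ℤ] [T.IsTriangulated] [T.EssSurj]
    (hT : ∀ {X Y : C} (f : T.obj X ⟶ T.obj Y), ∃ (Z : C) (s : Z ⟶ X) (_ : IsIso (T.map s))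
      (g : Z ⟶ Y), f = inv (T.map s) ≫ T.map g) :
    T.IsLocalization T.kernel.trW := by
  obtain ⟨Φ, _, _, α, -⟩ := exists_lift_verdierQ T.kernel T le_rfl
  have : (verdierQ T.kernel).EssSurj := Localization.essSurj _ T.kernel.trW
  have : (verdierQ T.kernel ⋙ Φ).EssSurj := Functor.essSurj_of_iso α.symm
  have : Φ.EssSurj :=
    ⟨fun Y => ⟨_, ⟨((verdierQ T.kernel ⋙ Φ).objObjPreimageIso Y)⟩⟩⟩
  have : Φ.Full := Φ.full_of_comp_essSurj (verdierQ T.kernel) fun X Y f => by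
    obtain ⟨Z, s, hs, g, hf⟩ := hT (α.inv.app X ≫ f ≫ α.hom.app Y)
    have : IsIso ((verdierQ T.kernel).map s) :=
      Localization.inverts _ T.kernel.trW s ((kernel_trW_iff T s).2 hs)
    refine ⟨inv ((verdierQ T.kernel).map s) ≫ (verdierQ T.kernel).map g, ?_⟩
    have h₁ := α.hom.naturality s
    have h₂ := α.hom.naturality g
    dsimp at h₁ h₂
    rw [Φ.map_comp, Φ.map_inv, IsIso.inv_comp_eq, ← cancel_mono (α.hom.app Y), h₂]
    have h₃ : f ≫ α.hom.app Y = α.hom.app X ≫ inv (T.map s) ≫ T.map g := by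
      rw [← hf]; simp
    rw [Category.assoc, h₃, ← Category.assoc, h₁]
    simp
  -- An object of the quotient comes from some `X` in `C`. If `Φ` kills it, then `T` kills `X`, so
  -- `X` is already zero in the quotient.
  have : Φ.Faithful := faithful_of_full_of_kernel Φ fun Y hY => by
    have e := (verdierQ T.kernel).objObjPreimageIso Y
    refine (e.isZero_iff).1 ?_
    have h0 : T.kernel ((verdierQ T.kernel).objPreimage Y) :=
      (α.app _).isZero_iff.1 ((Φ.mapIso e).isZero_iff.2 hY)
    exact le_kernel_verdierQ T.kernel _ h0
  have : Φ.IsEquivalence := {}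
  exact Functor.IsLocalization.of_equivalence_target (verdierQ T.kernel) T.kernel.trW T
    Φ.asEquivalence α

/-- Let `T` be a triangulated localization functor whose kernel is the thick subcategory generated
by the image of `S`. If the images under `T` of the objects of `P` generate the same thick
subcategory as `R`, then `T` induces an equivalence between the quotient of `C / thick P` by the
image of `S` and the quotient of `E` by `thick R`. -/
theorem exists_equivalence_verdierQuotient [IsTriangulated E] {M : Type*} [Category M]
    (T : C ⥤ E) [T.CommShift ℤ] [T.IsTriangulated] [T.IsLocalization T.kernel.trW]
    (F : M ⥤ C) (S : ObjectProperty M) [S.Nonempty] (P : ObjectProperty C) [P.Nonempty]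
    (R : ObjectProperty E) [R.Nonempty]
    (hS : ∀ X, S X → IsZero (T.obj (F.obj X))) (hT : T.kernel ≤ thick (S.map F))
    (hP : ∀ X, P X → thick R (T.obj X)) (hR : ∀ Y, R Y → ∃ X, P X ∧ Nonempty (T.obj X ≅ Y)) :
    ∃ (Φ : VerdierQuotient (thick (S.map (F ⋙ verdierQ (thick P)))) ⥤ VerdierQuotient (thick R))
      (_ : Φ.CommShift ℤ) (_ : Φ.IsTriangulated)
      (α : verdierQ (thick P) ⋙ verdierQ (thick (S.map (F ⋙ verdierQ (thick P)))) ⋙ Φ ≅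
        T ⋙ verdierQ (thick R)), NatTrans.CommShift α.hom ℤ ∧ Φ.IsEquivalence := by
  let q := verdierQ (thick P)
  let q' := verdierQ (thick (S.map (F ⋙ q)))
  let r := verdierQ (thick R)
  obtain ⟨Φ₁, _, _, α₁, _⟩ := exists_lift_verdierQ (thick P) (T ⋙ r)
    ((thick_le_iff _ _).2 fun X hX => le_kernel_verdierQ (thick R) _ (hP X hX))
  obtain ⟨Φ, _, _, α₂, _⟩ := exists_lift_verdierQ (thick (S.map (F ⋙ q))) Φ₁
    ((thick_le_iff _ _).2 (by
      rintro Y ⟨X, hX, ⟨e⟩⟩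
      exact (Φ₁.mapIso e).isZero_iff.1 ((α₁.app _).isZero_iff.2 (r.map_isZero (hS X hX)))))
  -- The inverse exists because `T` is itself a localization: by `hT` its kernel is generated by
  -- objects that die in the iterated quotient.
  obtain ⟨Ψ₁, _, _, β₁, _⟩ := exists_triangulated_lift T T.kernel.trW (q ⋙ q')
    (isInvertedBy_trW (hT.trans ((thick_le_iff _ _).2 (by
      rintro Y ⟨X, hX, ⟨e⟩⟩
      refine ((q ⋙ q').mapIso e).isZero_iff.1 ?_
      exact le_kernel_verdierQ _ _ (le_thick _ _ (S.prop_map_obj (F ⋙ q) hX))))))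
  obtain ⟨Ψ, _, _, β₂, _⟩ := exists_lift_verdierQ (thick R) Ψ₁
    ((thick_le_iff _ _).2 (by
      intro Y hY
      obtain ⟨X, hX, ⟨e⟩⟩ := hR Y hY
      exact (Ψ₁.mapIso e).isZero_iff.1 ((β₁.app _).isZero_iff.2
        (q'.map_isZero (le_kernel_verdierQ _ _ (le_thick _ _ hX))))))
  let α : q ⋙ q' ⋙ Φ ≅ T ⋙ r := Functor.isoWhiskerLeft q α₂ ≪≫ α₁
  have hα : NatTrans.CommShift α.hom ℤ := by dsimp [α]; infer_instance
  refine ⟨Φ, inferInstance, inferInstance, α, hα, ?_⟩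
  let β : T ⋙ r ⋙ Ψ ≅ q ⋙ q' := Functor.isoWhiskerLeft T β₂ ≪≫ β₁
  -- Both composites are the identity after precomposition with the localization functors, which are
  -- then cancelled one at a time.
  have e₁ : q ⋙ q' ⋙ Φ ⋙ Ψ ≅ q ⋙ q' := Functor.isoWhiskerRight α Ψ ≪≫ β
  have e₂ : T ⋙ r ⋙ Ψ ⋙ Φ ≅ T ⋙ r := Functor.isoWhiskerRight β Φ ≪≫ α
  let e₁ : q' ⋙ Φ ⋙ Ψ ≅ q' := Localization.liftNatIso q (thick P).trW _ _ _ _ e₁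
  let e₂ : r ⋙ Ψ ⋙ Φ ≅ r := Localization.liftNatIso T T.kernel.trW _ _ _ _ e₂
  exact (CategoryTheory.Equivalence.mk Φ Ψ
    (Localization.liftNatIso q' (thick (S.map (F ⋙ q))).trW _ _ _ _ e₁.symm)
    (Localization.liftNatIso r (thick R).trW _ _ _ _ e₂)).isEquivalence_functor

end Lift

/-! ### Termwise adjunction on complexes. -/

section MapComplex

variable {C : Type*} [Category C] [Preadditive C] {D : Type*} [Category D] [Preadditive D]
  {F : C ⥤ D} {G : D ⥤ C} [F.Additive] [G.Additive] (adj : G ⊣ F)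

/-- Termwise application of a fully faithful left adjoint gives a right inverse to termwise
application of the right adjoint. -/
def mapComplexUnitIso [IsIso adj.unit] (L : CochainComplex D ℤ) : L ≅
    (F.mapHomologicalComplex (ComplexShape.up ℤ)).obj
      ((G.mapHomologicalComplex (ComplexShape.up ℤ)).obj L) :=
  HomologicalComplex.Hom.isoOfComponents (fun i => (asIso adj.unit).app (L.X i))
    fun i j _ => (adj.unit.naturality (L.d i j)).symm

/-- The adjoint of a morphism of complexes, formed termwise. -/
def mapComplexAdjoint {L : CochainComplex D ℤ} {K : CochainComplex C ℤ}
    (u : L ⟶ (F.mapHomologicalComplex (ComplexShape.up ℤ)).obj K) :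
    (G.mapHomologicalComplex (ComplexShape.up ℤ)).obj L ⟶ K where
  f i := (adj.homEquiv _ _).symm (u.f i)
  comm' i j _ := by
    refine (adj.homEquiv_naturality_right_symm (u.f i) (K.d i j)).symm.trans
      (Eq.trans ?_ (adj.homEquiv_naturality_left_symm (L.d i j) (u.f j)))
    exact congrArg _ (u.comm i j)

/-- In each degree this is the formula recovering a morphism from its adjoint. It lifts the legs of
a roof along `F`. -/
lemma map_mapComplexAdjoint [IsIso adj.unit] {L : CochainComplex D ℤ} {K : CochainComplex C ℤ}
    (u : L ⟶ (F.mapHomologicalComplex (ComplexShape.up ℤ)).obj K) :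
    (mapComplexUnitIso adj L).hom ≫
      (F.mapHomologicalComplex (ComplexShape.up ℤ)).map (mapComplexAdjoint adj u) = u := by
  ext i
  exact (adj.homEquiv_unit _ _ _).symm.trans ((adj.homEquiv _ _).apply_symm_apply (u.f i))

end MapComplex

/-! ### Exact functors on bounded derived categories. -/

section MapBounded

open Pretriangulated DerivedCategory DerivedCategory.TStructure

variable {C : Type*} [Category C] [Abelian C] [HasDerivedCategory.{w₁} C]
  {D : Type*} [Category D] [Abelian D] [HasDerivedCategory.{w₂} D]

lemma exists_iso_Q_obj_of_bounded (X : DerivedCategory.Bounded C) :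
    ∃ (K : CochainComplex C ℤ) (a b : ℤ) (_ : K.IsStrictlyGE a) (_ : K.IsStrictlyLE b),
      Nonempty (X.obj ≅ DerivedCategory.Q.obj K) := by
  obtain ⟨X, ⟨a, _⟩, ⟨b, _⟩⟩ := X
  obtain ⟨K, _, _, e⟩ := exists_iso_Q_obj_of_isGE_of_isLE X a b
  exact ⟨K, a, b, inferInstance, inferInstance, e⟩

lemma bounded_Q_obj (K : CochainComplex C ℤ) (a b : ℤ) [K.IsStrictlyGE a] [K.IsStrictlyLE b] :
    t.bounded (DerivedCategory.Q.obj K) :=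
  ⟨⟨a, inferInstance⟩, ⟨b, inferInstance⟩⟩

section

variable (F : C ⥤ D) [F.PreservesZeroMorphisms] (K : CochainComplex C ℤ) (n : ℤ)

instance isStrictlyLE_map [K.IsStrictlyLE n] : CochainComplex.IsStrictlyLE
    ((F.mapHomologicalComplex (ComplexShape.up ℤ)).obj K) n :=
  (CochainComplex.isStrictlyLE_iff _ _).2 fun i hi =>
    F.map_isZero (K.isZero_of_isStrictlyLE n i hi)

instance isStrictlyGE_map [K.IsStrictlyGE n] : CochainComplex.IsStrictlyGE
    ((F.mapHomologicalComplex (ComplexShape.up ℤ)).obj K) n :=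
  (CochainComplex.isStrictlyGE_iff _ _).2 fun i hi =>
    F.map_isZero (K.isZero_of_isStrictlyGE n i hi)

end

section

variable (F : C ⥤ D) [F.Additive] [PreservesFiniteLimits F] [PreservesFiniteColimits F]
  (X : DerivedCategory C) (n : ℤ)

instance isLE_mapDerivedCategory [X.IsLE n] : (F.mapDerivedCategory.obj X).IsLE n := by
  obtain ⟨K, _, ⟨e⟩⟩ := exists_iso_Q_obj_of_isLE X n
  let e' : F.mapDerivedCategory.obj X ≅ DerivedCategory.Q.obj
      ((F.mapHomologicalComplex (ComplexShape.up ℤ)).obj K) :=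
    F.mapDerivedCategory.mapIso e ≪≫ F.mapDerivedCategoryFactors.app K
  exact t.isLE_of_iso e'.symm n

instance isGE_mapDerivedCategory [X.IsGE n] : (F.mapDerivedCategory.obj X).IsGE n := by
  obtain ⟨K, _, ⟨e⟩⟩ := exists_iso_Q_obj_of_isGE X n
  let e' : F.mapDerivedCategory.obj X ≅ DerivedCategory.Q.obj
      ((F.mapHomologicalComplex (ComplexShape.up ℤ)).obj K) :=
    F.mapDerivedCategory.mapIso e ≪≫ F.mapDerivedCategoryFactors.app K
  exact t.isGE_of_iso e'.symm n

lemma isZero_of_isZero_singleFunctor_obj (Y : C) (h : IsZero ((singleFunctor C n).obj Y)) :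
    IsZero Y := by
  rw [IsZero.iff_id_eq_zero]
  exact (singleFunctor C n).map_injective (h.eq_of_src _ _)

end

section

variable (F : C ⥤ D) [F.Additive] [PreservesFiniteLimits F] [PreservesFiniteColimits F]

/-- Induction on the amplitude: an exact functor respects truncations, so it kills a complex only if
it kills both truncations. -/
lemma kernel_boundedMap_le_thick_of_isLE (k : ℕ) (X : DerivedCategory.Bounded C) (a : ℤ)
    (h₁ : X.obj.IsGE a) (h₂ : X.obj.IsLE (a + k)) (hX : IsZero ((boundedMap F).obj X)) :
    thick (F.kernel.map stalk) X := by
  induction k generalizing X a with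
  | zero =>
    have : X.obj.IsLE a := by simpa using h₂
    obtain ⟨Y, ⟨e⟩⟩ := exists_iso_singleFunctor_obj_of_isGE_of_isLE X.obj a
    have hY : F.kernel Y := isZero_of_isZero_singleFunctor_obj a _
      (((F.mapDerivedCategory.mapIso e ≪≫
        (F.mapDerivedCategorySingleFunctor a).app Y).isZero_iff).1
        (Bounded.ι.map_isZero hX))
    have e' : (stalk.obj Y)⟦-a⟧ ≅ X := ObjectProperty.isoMk _
      ((Bounded.ι.commShiftIso (-a)).app _ ≪≫
        ((singleFunctors C).shiftIso (-a) a 0 (by simp)).app Y ≪≫ e.symm)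
    exact (thick _).prop_of_iso e' ((thick (F.kernel.map stalk)).le_shift _ _
      (le_thick _ _ (F.kernel.prop_map_obj stalk hY)))
  | succ k ih =>
    let t' := (t : Triangulated.TStructure (DerivedCategory C)).onBounded
    have : t'.IsGE X a := ⟨h₁.1⟩
    have hd := t'.triangleLEGE_distinguished a (a + 1) rfl X
    let X₁ := (t'.truncLE a).obj X
    let X₂ := (t'.truncGE (a + 1)).obj X
    have h₁₁ : X₁.obj.IsLE a := ⟨(inferInstance : t'.IsLE X₁ a).1⟩
    have h₁₂ : X₁.obj.IsGE a := ⟨(inferInstance : t'.IsGE X₁ a).1⟩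
    have : t'.IsLE X (a + (k + 1 :)) := ⟨h₂.1⟩
    have h₂₁ : X₂.obj.IsGE (a + 1) := ⟨(inferInstance : t'.IsGE X₂ (a + 1)).1⟩
    have h₂₂ : X₂.obj.IsLE (a + (k + 1 :)) := ⟨(inferInstance : t'.IsLE X₂ _).1⟩
    have hd' := (boundedMap F).map_distinguished _ hd
    -- The middle term of the image triangle vanishes, so its connecting morphism is invertible. It
    -- joins an object in degrees `≥ a + 1` to one in degrees `≤ a - 1`, hence both are zero.
    have e : (boundedMap F).obj X₂ ≅ ((boundedMap F).obj X₁)⟦(1 : ℤ)⟧ :=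
      have : IsIso ((boundedMap F).mapTriangle.obj ((t'.triangleLEGE a (a + 1) rfl).obj X)).mor₃ :=
        (Triangle.isZero₂_iff_isIso₃ _ hd').1 hX
      @asIso _ _ _ _ _ this
    let s := (t : Triangulated.TStructure (DerivedCategory D)).onBounded
    have : s.IsLE ((boundedMap F).obj X₁) a := ⟨(isLE_mapDerivedCategory F X₁.obj a).1⟩
    have : s.IsGE ((boundedMap F).obj X₂) (a + 1) := ⟨(isGE_mapDerivedCategory F X₂.obj _).1⟩
    have : s.IsLE (((boundedMap F).obj X₁)⟦(1 : ℤ)⟧) (a - 1) := s.isLE_shift _ a 1 _ (by lia)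
    have : s.IsLE ((boundedMap F).obj X₂) (a - 1) := s.isLE_of_iso e.symm _
    have h₂ : IsZero ((boundedMap F).obj X₂) := s.isZero _ (a - 1) (a + 1)
    have h₁ : IsZero ((boundedMap F).obj X₁) :=
      Triangle.isZero₁_of_isZero₂₃ _ hd' hX h₂
    exact (thick (F.kernel.map stalk)).ext_of_isTriangulatedClosed₂ _ hd
      (ih X₁ a h₁₂ (t.isLE_of_le _ a _ (by lia)) h₁)
      (ih X₂ (a + 1) h₂₁ (t.isLE_of_le _ (a + (k + 1 :)) _ (by lia)) h₂)

lemma kernel_boundedMap_le_thick : (boundedMap F).kernel ≤ thick (F.kernel.map stalk) := by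
  rintro ⟨X, ⟨a, ha⟩, ⟨b, hb⟩⟩ hX
  -- If `b < a`, then `toNat` returns `0`, and `a` is still an upper bound.
  exact kernel_boundedMap_le_thick_of_isLE F (b - a).toNat _ a ha
    (t.isLE_of_le _ b _ (by lia)) hX

end

section

variable {F : C ⥤ D} {G : D ⥤ C} [F.Additive] [G.Additive] (adj : G ⊣ F) [IsIso adj.unit]
  [PreservesFiniteLimits F] [PreservesFiniteColimits F]

include adj in
-- Applying `G` termwise to a representing complex gives a preimage, since `F` undoes `G`. It does
-- not matter whether `G` preserves quasi-isomorphisms.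
lemma boundedMap_essSurj : (boundedMap F).EssSurj where
  mem_essImage Y := by
    obtain ⟨L, a, b, _, _, ⟨e⟩⟩ := exists_iso_Q_obj_of_bounded Y
    exact ⟨⟨_, bounded_Q_obj ((G.mapHomologicalComplex (ComplexShape.up ℤ)).obj L) a b⟩,
      ⟨ObjectProperty.isoMk _ (F.mapDerivedCategoryFactors.app _ ≪≫
        DerivedCategory.Q.mapIso (mapComplexUnitIso adj L).symm ≪≫ e.symm)⟩⟩

include adj in
-- A morphism in the target is a roof of maps out of a complex `N`. The termwise adjoints of its
-- legs start at `G N` and form the required roof.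
lemma exists_rightFraction_mapDerivedCategory {K L : CochainComplex C ℤ} (a b : ℤ)
    [K.IsStrictlyGE a] [K.IsStrictlyLE b] [L.IsStrictlyGE a]
    (f : F.mapDerivedCategory.obj (DerivedCategory.Q.obj K) ⟶
      F.mapDerivedCategory.obj (DerivedCategory.Q.obj L)) :
    ∃ (M : CochainComplex C ℤ) (_ : M.IsStrictlyGE a) (_ : M.IsStrictlyLE b) (s : M ⟶ K)
      (_ : IsIso (F.mapDerivedCategory.map (DerivedCategory.Q.map s))) (g : M ⟶ L),
      F.mapDerivedCategory.map (DerivedCategory.Q.map s) ≫ f =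
        F.mapDerivedCategory.map (DerivedCategory.Q.map g) := by
  obtain ⟨N, _, _, s, hs, g, hf⟩ := right_fac_of_isStrictlyLE_of_isStrictlyGE a b
    (F.mapDerivedCategoryFactors.inv.app K ≫ f ≫ F.mapDerivedCategoryFactors.hom.app L)
  let e : F.mapDerivedCategory.obj (DerivedCategory.Q.obj
      ((G.mapHomologicalComplex (ComplexShape.up ℤ)).obj N)) ≅ DerivedCategory.Q.obj N :=
    F.mapDerivedCategoryFactors.app _ ≪≫ DerivedCategory.Q.mapIso (mapComplexUnitIso adj N).symm
  have key {K : CochainComplex C ℤ}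
      (u : N ⟶ (F.mapHomologicalComplex (ComplexShape.up ℤ)).obj K) :
      -- Up to canonical isomorphisms, applying `F` to the adjoint of a leg returns the leg. In
      -- particular the adjoint of `s` becomes invertible.
      F.mapDerivedCategory.map (DerivedCategory.Q.map (mapComplexAdjoint adj u)) =
        e.hom ≫ DerivedCategory.Q.map u ≫ F.mapDerivedCategoryFactors.inv.app K := by
    have h₁ := F.mapDerivedCategoryFactors_hom_naturality (mapComplexAdjoint adj u)
    have h₂ := DerivedCategory.Q.congr_map (map_mapComplexAdjoint adj u)
    rw [Functor.map_comp] at h₂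
    rw [← h₂, ← cancel_mono (F.mapDerivedCategoryFactors.hom.app K), h₁]
    simp only [Category.assoc, Iso.inv_hom_id_app]
    simp [e]
  refine ⟨(G.mapHomologicalComplex (ComplexShape.up ℤ)).obj N, inferInstance, inferInstance,
    mapComplexAdjoint adj s, by rw [key]; infer_instance, mapComplexAdjoint adj g, ?_⟩
  rw [key, key, ← cancel_mono (F.mapDerivedCategoryFactors.hom.app L)]
  simp only [Category.assoc, hf, IsIso.hom_inv_id_assoc, Iso.inv_hom_id_app]
  exact congrArg _ (Category.comp_id (DerivedCategory.Q.map g)).symm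

include adj in
lemma exists_rightFraction_boundedMap {X Y : DerivedCategory.Bounded C}
    (f : (boundedMap F).obj X ⟶ (boundedMap F).obj Y) :
    ∃ (Z : DerivedCategory.Bounded C) (s : Z ⟶ X) (_ : IsIso ((boundedMap F).map s))
      (g : Z ⟶ Y), f = inv ((boundedMap F).map s) ≫ (boundedMap F).map g := by
  obtain ⟨K, a, b, _, _, ⟨e⟩⟩ := exists_iso_Q_obj_of_bounded X
  obtain ⟨L, a', b', _, _, ⟨e'⟩⟩ := exists_iso_Q_obj_of_bounded Y
  -- The roof is taken in degrees `[min a a', b]`, which needs a lower bound common to `K` and `L`.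
  have : K.IsStrictlyGE (min a a') := K.isStrictlyGE_of_ge _ a (min_le_left _ _)
  have : L.IsStrictlyGE (min a a') := L.isStrictlyGE_of_ge _ a' (min_le_right _ _)
  obtain ⟨M, _, _, s, hs, g, hf⟩ := exists_rightFraction_mapDerivedCategory adj (min a a') b
    (F.mapDerivedCategory.map e.inv ≫ f.hom ≫ F.mapDerivedCategory.map e'.hom)
  have hs' : IsIso ((boundedMap F).map (X := ⟨_, bounded_Q_obj M (min a a') b⟩) (Y := X)
      (ObjectProperty.homMk (DerivedCategory.Q.map s ≫ e.inv))) := by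
    rw [← ObjectProperty.isIso_hom_iff]
    change IsIso (F.mapDerivedCategory.map (DerivedCategory.Q.map s ≫ e.inv))
    rw [Functor.map_comp]
    infer_instance
  refine ⟨⟨_, bounded_Q_obj M (min a a') b⟩,
    ObjectProperty.homMk (DerivedCategory.Q.map s ≫ e.inv), hs',
    ObjectProperty.homMk (DerivedCategory.Q.map g ≫ e'.inv), ?_⟩
  rw [IsIso.eq_inv_comp]
  ext
  change F.mapDerivedCategory.map (_ ≫ _) ≫ f.hom = F.mapDerivedCategory.map (_ ≫ _)
  simp only [Functor.map_comp, ← hf, Category.assoc]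
  rw [show F.mapDerivedCategory.map e'.hom ≫ F.mapDerivedCategory.map e'.inv = 𝟙 _ from
    (F.mapDerivedCategory.mapIso e').hom_inv_id]
  exact congrArg _ (congrArg _ (Category.comp_id f.hom).symm)

include adj in
/-- If an exact functor `F` has a fully faithful left adjoint, then the functor induced by `F`
between bounded derived categories is a Verdier quotient functor. -/
lemma boundedMap_isLocalization : (boundedMap F).IsLocalization (boundedMap F).kernel.trW :=
  have := boundedMap_essSurj adj
  isLocalization_kernel _ (exists_rightFraction_boundedMap adj)

end

end MapBounded

/-! ### The left adjoint `- ⊗_{eAe} eA` and its unit. -/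

section Induced

open scoped TensorProduct

variable {A : Type u} [Ring A] {e : A} (he : IsIdempotentElem e)

section

variable (T : Type u) [AddCommGroup T] [Module he.Cornerᵐᵒᵖ T]

/-- The relations `r x ⊗ t = x ⊗ t r` for `r ∈ eAe` that define `T ⊗_{eAe} eA`. -/
def inducedRelations : Submodule Aᵐᵒᵖ (rightIdeal e ⊗[ℤ] T) :=
  Submodule.span Aᵐᵒᵖ {z | ∃ (r : he.Corner) (x : rightIdeal e) (t : T),
    cornerMul he r x ⊗ₜ[ℤ] t - x ⊗ₜ[ℤ] (op r • t) = z}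

/-- The right `A`-module `T ⊗_{eAe} eA` induced by a right `eAe`-module `T`. -/
abbrev Induced : Type u := (rightIdeal e ⊗[ℤ] T) ⧸ inducedRelations he T

variable {T}

/-- The element `t ⊗ x` of the induced module. -/
def Induced.tmul (x : rightIdeal e) (t : T) : Induced he T :=
  (inducedRelations he T).mkQ (x ⊗ₜ[ℤ] t)

variable (x y : rightIdeal e) (t u : T)

lemma Induced.add_tmul : tmul he (x + y) t = tmul he x t + tmul he y t := by
  rw [tmul, TensorProduct.add_tmul, map_add]; rfl

lemma Induced.tmul_add : tmul he x (t + u) = tmul he x t + tmul he x u := by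
  rw [tmul, TensorProduct.tmul_add, map_add]; rfl

lemma Induced.smul_tmul (a : Aᵐᵒᵖ) : a • tmul he x t = tmul he (a • x) t := rfl

lemma Induced.cornerMul_tmul (r : he.Corner) :
    tmul he (cornerMul he r x) t = tmul he x (op r • t) := by
  rw [← sub_eq_zero, tmul, tmul, ← map_sub]
  exact (Submodule.Quotient.mk_eq_zero _).2 (Submodule.subset_span ⟨r, x, t, rfl⟩)

variable {he} in
lemma Induced.induction_on {p : Induced he T → Prop} (z : Induced he T)
    (tmul : ∀ x t, p (tmul he x t)) (add : ∀ y z, p y → p z → p (y + z)) : p z := by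
  obtain ⟨z, rfl⟩ := Submodule.mkQ_surjective _ z
  induction z using TensorProduct.induction_on with
  | zero => simpa [Induced.tmul] using tmul 0 0
  | tmul x t => exact tmul x t
  | add y z hy hz => rw [map_add]; exact add _ _ hy hz

/-- The map `eA → eAe`, `x ↦ x e`. -/
def toCorner : rightIdeal e →+ he.Corner where
  toFun x := ⟨x.1 * e, by obtain ⟨_, a, rfl⟩ := x; exact ⟨a, rfl⟩⟩
  map_zero' := Subtype.ext (zero_mul e)
  map_add' _ _ := Subtype.ext (add_mul _ _ _)

/-- Writing `x e` as `(x e) · e` with `x e` in `eAe` allows this factor to move across the tensor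
sign. -/
lemma cornerMul_toCorner_gen (x : rightIdeal e) :
    cornerMul he (toCorner he x) (gen e) = op e • x :=
  Subtype.ext (show x.1 * e * e = x.1 * e by rw [mul_assoc, he.eq])

lemma Induced.exists_gen_tmul (z : Induced he T) : ∃ t : T, op e • z = tmul he (gen e) t := by
  induction z using Induced.induction_on with
  | tmul x t =>
    exact ⟨op (toCorner he x) • t, by
      rw [smul_tmul, ← cornerMul_toCorner_gen, cornerMul_tmul]⟩
  | add y z hy hz =>
    obtain ⟨t, ht⟩ := hy
    obtain ⟨u, hu⟩ := hz
    exact ⟨t + u, by rw [smul_add, ht, hu, tmul_add]⟩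

variable (T) in
/-- The additive map `eA ⊗ T → T`, `x ⊗ t ↦ t x e`. -/
def tensorToCornerModule : rightIdeal e ⊗[ℤ] T →+ T :=
  TensorProduct.liftAddHom
    { toFun := fun x => DistribSMul.toAddMonoidHom T (op (toCorner he x))
      map_zero' := AddMonoidHom.ext fun t => by
        change op (toCorner he 0) • t = 0
        rw [map_zero]
        exact zero_smul he.Cornerᵐᵒᵖ t
      map_add' := fun x y => AddMonoidHom.ext fun t => by
        change op (toCorner he (x + y)) • t = op (toCorner he x) • t + op (toCorner he y) • t
        rw [map_add, MulOpposite.op_add, add_smul] }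
    fun n x t => by
      change op (toCorner he (n • x)) • t = op (toCorner he x) • n • t
      rw [map_zsmul, op_smul, smul_assoc, smul_comm]

lemma tensorToCornerModule_tmul :
    tensorToCornerModule he T (x ⊗ₜ t) = op (toCorner he x) • t := rfl

/-- Thus `x ⊗ t ↦ t x e` descends to the induced module, where it retracts `t ↦ e ⊗ t`. This gives
injectivity of the unit. -/
lemma tensorToCornerModule_eq_zero {z : rightIdeal e ⊗[ℤ] T} (hz : z ∈ inducedRelations he T) :
    tensorToCornerModule he T z = 0 := by
  -- The map is only additive, so the induction over the `A`-span must carry an arbitrary scalar.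
  suffices ∀ a : Aᵐᵒᵖ, tensorToCornerModule he T (a • z) = 0 by simpa using this 1
  induction hz using Submodule.span_induction with
  | mem z hz =>
    obtain ⟨r, x, t, rfl⟩ := hz
    intro a
    rw [smul_sub, map_sub, TensorProduct.smul_tmul', TensorProduct.smul_tmul',
      tensorToCornerModule_tmul, tensorToCornerModule_tmul, smul_smul, sub_eq_zero, ← op_mul]
    congr 2
    exact Subtype.ext (show r.1 * x.1 * a.unop * e = r.1 * (x.1 * a.unop * e) by
      simp only [mul_assoc])
  | zero => simp
  | add x y _ _ hx hy => intro a; rw [smul_add, map_add, hx, hy, add_zero]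
  | smul b x _ hx => intro a; rw [smul_smul]; exact hx _

lemma Induced.gen_tmul_injective (h : tmul he (gen e) t = tmul he (gen e) u) : t = u := by
  rw [← sub_eq_zero, tmul, tmul, ← map_sub, ← TensorProduct.tmul_sub] at h
  have h := tensorToCornerModule_eq_zero he ((Submodule.Quotient.mk_eq_zero _).1 h)
  have hg : toCorner he (gen e) = 1 := Subtype.ext he.eq
  rwa [tensorToCornerModule_tmul, hg, op_one, one_smul, sub_eq_zero] at h

/-- If `s` generates `T`, the elements `e ⊗ t` with `t ∈ s` generate: `x ⊗ t = (e ⊗ t) x`, and `e ⊗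
t r = (e ⊗ t) r` for `r ∈ eAe`. -/
instance [Module.Finite he.Cornerᵐᵒᵖ T] : Module.Finite Aᵐᵒᵖ (Induced he T) := by
  obtain ⟨s, hs⟩ := Module.Finite.fg_top (R := he.Cornerᵐᵒᵖ) (M := T)
  classical
  refine ⟨s.image (Induced.tmul he (gen e)), top_le_iff.1 fun z _ => ?_⟩
  set N := Submodule.span Aᵐᵒᵖ (s.image (Induced.tmul he (gen e)) : Set (Induced he T))
  have key (t : T) : Induced.tmul he (gen e) t ∈ N := by
    have ht : t ∈ Submodule.span he.Cornerᵐᵒᵖ (s : Set T) := hs ▸ trivial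
    induction ht using Submodule.span_induction with
    | mem t ht => exact Submodule.subset_span (Finset.mem_coe.2 (Finset.mem_image_of_mem _ ht))
    | zero => simp [Induced.tmul]
    | add t u _ _ ht hu => rw [Induced.tmul_add]; exact N.add_mem ht hu
    | smul r t _ ht =>
      have h := Induced.cornerMul_tmul he (gen e) t r.unop
      have hr : cornerMul he r.unop (gen e) = op r.unop.1 • gen e := by
        refine Subtype.ext (show r.unop.1 * e = e * r.unop.1 from ?_)
        rw [((Subsemigroup.mem_corner_iff he).1 r.unop.2).1,
          ((Subsemigroup.mem_corner_iff he).1 r.unop.2).2]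
      rw [hr, ← Induced.smul_tmul] at h
      rw [← op_unop r, ← h]
      exact N.smul_mem _ ht
  induction z using Induced.induction_on with
  | tmul x t =>
    have hx : x = op x.1 • gen e := by
      obtain ⟨_, a, rfl⟩ := x
      exact Subtype.ext (show e * a = e * (e * a) by rw [← mul_assoc, he.eq])
    rw [hx, ← Induced.smul_tmul]
    exact N.smul_mem _ (key t)
  | add y z hy hz => exact N.add_mem (hy trivial) (hz trivial)

variable {M : Type u} [AddCommGroup M] [Module Aᵐᵒᵖ M]

variable (T) in
/-- The unit `T → Hom_A(eA, T ⊗_{eAe} eA)`. -/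
def inducedUnit : T →ₗ[he.Cornerᵐᵒᵖ] CornerHom he (Induced he T) where
  toFun t := ({ toFun := fun x => Induced.tmul he x t
                map_add' := fun x y => Induced.add_tmul he x y t
                map_smul' := fun _ _ => rfl } : rightIdeal e →ₗ[Aᵐᵒᵖ] Induced he T)
  map_add' t u := LinearMap.ext fun x => Induced.tmul_add he x t u
  map_smul' r t := LinearMap.ext fun x => (Induced.cornerMul_tmul he x t r.unop).symm

/-- A map `φ` out of `eA` is determined by `φ(e) = φ(e) e`, and every element of the form `z e` in
the induced module is `e ⊗ t` for a unique `t`. -/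
lemma inducedUnit_bijective : Function.Bijective (inducedUnit he T) := by
  constructor
  · intro t u h
    exact Induced.gen_tmul_injective he t u
      (LinearMap.congr_fun (show CornerHom.toHom he _ = CornerHom.toHom he _ from h) (gen e))
  · intro φ
    obtain ⟨t, ht⟩ := Induced.exists_gen_tmul he (CornerHom.toHom he φ (gen e))
    exact ⟨t, CornerHom.ext_gen he (ht.symm.trans (CornerHom.toHom_apply he _ φ (gen e)).symm)⟩

/-- The `A`-linear map `T ⊗_{eAe} eA → M` induced by an `eAe`-linear map `T → Hom_A(eA, M)`. -/
def inducedLift (h : T →ₗ[he.Cornerᵐᵒᵖ] CornerHom he M) : Induced he T →ₗ[Aᵐᵒᵖ] M :=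
  (inducedRelations he T).liftQ (TensorProduct.AlgebraTensorModule.lift
    { toFun := fun x => AddMonoidHom.toIntLinearMap
        { toFun := fun t => CornerHom.toHom he (h t) x
          map_zero' := by rw [map_zero]; rfl
          map_add' := fun t u => by rw [map_add]; rfl }
      map_add' := fun x y => LinearMap.ext fun t => map_add (CornerHom.toHom he (h t)) x y
      map_smul' := fun a x => LinearMap.ext fun t => map_smul (CornerHom.toHom he (h t)) a x })
    (by
      rw [inducedRelations, Submodule.span_le]
      rintro _ ⟨r, x, t, rfl⟩
      change _ = _
      rw [map_sub, sub_eq_zero]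
      change CornerHom.toHom he (h t) _ = CornerHom.toHom he (h _) _
      rw [map_smul]
      rfl)

end

variable [IsNoetherianRing Aᵐᵒᵖ]

/-- The adjunction bijection between maps `T ⊗_{eAe} eA → M` and maps `T → Hom_A(eA, M)`. -/
def inducedHomEquiv (T : FGModuleCat.{u} he.Cornerᵐᵒᵖ) (M : FGModuleCat.{u} Aᵐᵒᵖ) :
    (FGModuleCat.of Aᵐᵒᵖ (Induced he T) ⟶ M) ≃ (T ⟶ (homFunctor he).obj M) where
  toFun g := FGModuleCat.ofHom (inducedUnit he T) ≫ (homFunctor he).map g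
  invFun h := FGModuleCat.ofHom (W := M) (inducedLift he h.hom.hom)
  left_inv g := by
    refine FGModuleCat.hom_ext (LinearMap.ext fun z => ?_)
    induction z using Induced.induction_on with
    | tmul x t => rfl
    | add y z hy hz => rw [map_add, map_add, hy, hz]
  right_inv h := by
    ext t
    rfl

/-- The functor `- ⊗_{eAe} eA` from finitely generated right `eAe`-modules to finitely generated
right `A`-modules. -/
def inducedFunctor : FGModuleCat.{u} he.Cornerᵐᵒᵖ ⥤ FGModuleCat.{u} Aᵐᵒᵖ :=
  Adjunction.leftAdjointOfEquiv (inducedHomEquiv he) fun _ _ _ _ _ => rfl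

/-- `- ⊗_{eAe} eA` is left adjoint to `Hom_A(eA, -)`. -/
def inducedAdjunction : inducedFunctor he ⊣ homFunctor he :=
  Adjunction.adjunctionOfEquivLeft (inducedHomEquiv he) fun _ _ _ _ _ => rfl

instance : IsIso (inducedAdjunction he).unit := by
  rw [NatTrans.isIso_iff_isIso_app]
  intro T
  have h : (inducedAdjunction he).unit.app T =
      (LinearEquiv.ofBijective (inducedUnit he T) (inducedUnit_bijective he)).toFGModuleCatIso.hom := by
    rfl
  rw [h]
  exact Iso.isIso_hom _

end Induced

/-! ### Modules killed by `Hom_A(eA, -)`. -/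

section Kernel

variable {A : Type u} [Ring A] {e : A} (he : IsIdempotentElem e)

lemma subsingleton_cornerHom_iff (M : Type u) [AddCommGroup M] [Module Aᵐᵒᵖ M] :
    Subsingleton (CornerHom he M) ↔ ∀ m : M, op e • m = 0 := by
  constructor
  · intro h m
    exact LinearMap.congr_fun (show CornerHom.toHom he (CornerHom.ofElem he m) =
      CornerHom.toHom he 0 from congrArg _ (Subsingleton.elim _ _)) (gen e)
  · intro h
    refine ⟨fun φ ψ => CornerHom.ext_gen he ?_⟩
    rw [CornerHom.toHom_apply he M φ, CornerHom.toHom_apply he M ψ]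
    exact (h _).trans (h _).symm

/-- The action of `A / AeA` on a right `A`-module annihilated by `e`. -/
def quotientAction (M : Type u) [AddCommGroup M] [Module Aᵐᵒᵖ M] (h : ∀ m : M, op e • m = 0) :
    QuotientRing e →+* (AddMonoid.End M)ᵐᵒᵖ :=
  let φ : A →+* (AddMonoid.End M)ᵐᵒᵖ :=
    (Module.toAddMonoidEnd Aᵐᵒᵖ M).op.comp (RingEquiv.opOp A).toRingHom
  RingCon.lift _ φ (by
    have : TwoSidedIdeal.span {e} ≤ TwoSidedIdeal.ker φ := by
      rw [TwoSidedIdeal.span_le, Set.singleton_subset_iff]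
      exact (TwoSidedIdeal.mem_ker _).2 (unop_injective (AddMonoidHom.ext h))
    intro x y hxy
    have := (TwoSidedIdeal.mem_ker _).1 (this (((TwoSidedIdeal.span {e}).rel_iff x y).1 hxy))
    rw [map_sub, sub_eq_zero] at this
    exact this)

lemma quotientMap_self : quotientMap e e = 0 :=
  (TwoSidedIdeal.span {e}).ringCon.eq.2
    (((TwoSidedIdeal.span {e}).rel_iff e 0).2 (by
      rw [sub_zero]; exact TwoSidedIdeal.subset_span rfl))

/-- A module killed by `e` is killed by `AeA`, so the action descends to `A/AeA`, and the same
finite set generates. -/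
lemma modQuotient_iff (M : FGModuleCat.{u} Aᵐᵒᵖ) :
    modQuotient e M ↔ ∀ m : M, op e • m = 0 := by
  constructor
  · rintro ⟨N, ⟨i⟩⟩ m
    obtain ⟨n, rfl⟩ := i.toLinearEquiv.surjective m
    rw [← map_smul]
    have : op e • n = op (quotientMap e e) • (show N from n) := rfl
    rw [this, quotientMap_self, MulOpposite.op_zero]
    exact (congrArg _ (zero_smul _ (show N from n))).trans (map_zero i.toLinearEquiv)
  · intro h
    let _ : Module (QuotientRing e)ᵐᵒᵖ M := Module.compHom M
      ((RingEquiv.opOp (AddMonoid.End M)).symm.toRingHom.comp (quotientAction M h).op)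
    have : Module.Finite (QuotientRing e)ᵐᵒᵖ M := by
      obtain ⟨s, hs⟩ := Module.Finite.fg_top (R := Aᵐᵒᵖ) (M := M)
      refine ⟨s, top_le_iff.1 fun m _ => ?_⟩
      have hm : m ∈ Submodule.span Aᵐᵒᵖ (s : Set M) := hs ▸ trivial
      induction hm using Submodule.span_induction with
      | mem m hm => exact Submodule.subset_span hm
      | zero => exact zero_mem _
      | add x y _ _ hx hy => exact add_mem (hx trivial) (hy trivial)
      | smul a x _ hx => exact Submodule.smul_mem _ (op (quotientMap e a.unop)) (hx trivial)
    refine ⟨FGModuleCat.of _ M, ⟨LinearEquiv.toModuleIso (X₂ := M)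
      { AddEquiv.refl M with map_smul' := fun a m => rfl }⟩⟩

variable [IsNoetherianRing Aᵐᵒᵖ]

lemma kernel_homFunctor_iff (M : FGModuleCat.{u} Aᵐᵒᵖ) :
    (homFunctor he).kernel M ↔ ∀ m : M, op e • m = 0 := by
  rw [← subsingleton_cornerHom_iff he]
  change IsZero _ ↔ _
  let V := forget₂ (FGModuleCat.{u} he.Cornerᵐᵒᵖ) (ModuleCat.{u} he.Cornerᵐᵒᵖ)
  constructor
  · intro h
    exact ModuleCat.isZero_iff_subsingleton.1 (V.map_isZero h)
  · intro h
    exact IsZero.of_full_of_faithful_of_isZero V _ (ModuleCat.isZero_iff_subsingleton.2 h)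

lemma kernel_homFunctor : (homFunctor he).kernel = modQuotient e := by
  ext M
  rw [kernel_homFunctor_iff, modQuotient_iff]

end Kernel

/-! ### The image of `fA`. -/

section Generators

variable {A : Type u} [Ring A] {e : A} (f : A) (he : IsIdempotentElem e)

/-- `Hom_A(eA, fA) ≅ fAe`. -/
def cornerHomRightIdealEquiv :
    BiCorner f he ≃ₗ[he.Cornerᵐᵒᵖ] CornerHom he (rightIdeal f) :=
  LinearEquiv.ofBijective
    { toFun := fun x => CornerHom.ofElem he (M := rightIdeal f)
        ⟨x.1, by obtain ⟨_, a, rfl⟩ := x; exact ⟨a * e, (mul_assoc _ _ _).symm⟩⟩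
      map_add' := fun x y => LinearMap.ext fun z => Subtype.ext (add_mul x.1 y.1 z.1)
      map_smul' := fun r x => LinearMap.ext fun z => Subtype.ext (mul_assoc x.1 r.unop.1 z.1) }
    (by
      constructor
      · rintro ⟨_, a, rfl⟩ ⟨_, b, rfl⟩ h
        have h' : f * a * e * e = f * b * e * e := congrArg Subtype.val (LinearMap.congr_fun
          (show CornerHom.toHom he _ = CornerHom.toHom he _ from h) (gen e))
        rw [mul_assoc, mul_assoc _ e e, he.eq] at h'
        exact Subtype.ext h'
      · intro φ
        have hφ := CornerHom.toHom_apply he _ φ (gen e)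
        obtain ⟨a, ha⟩ := (CornerHom.toHom he φ (gen e)).2
        -- Here `φ(e) = f a`, and `φ(e) = φ(e) e`, so `φ` is left multiplication by `f a e`.
        refine ⟨⟨f * a * e, a, rfl⟩, CornerHom.ext_gen he (Eq.trans ?_ hφ.symm)⟩
        refine Subtype.ext (show f * a * e * e = (CornerHom.toHom he φ (gen e)).1 * e from ?_)
        rw [← ha, mul_assoc _ e e, he.eq])

end Generators

end TwoIdempotents

end

/-! ### The equivalence for `e` and `f`. -/

open TwoIdempotents in
theorem propositionP {A : Type u} [Ring A] [IsNoetherianRing Aᵐᵒᵖ] {e f : A}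
    (he : IsIdempotentElem e) (hf : IsIdempotentElem f)
    [HasDerivedCategory.{w₁} (FGModuleCat.{u} Aᵐᵒᵖ)]
    [HasDerivedCategory.{w₂} (FGModuleCat.{u} he.Cornerᵐᵒᵖ)] :
    ∃ (Φ : VerdierQuotient (thickModQuotient e f) ⥤ VerdierQuotient (thickBiCorner f he))
      (_ : Φ.CommShift ℤ) (_ : Φ.IsTriangulated)
      (α : verdierQ (thickRightIdeal f) ⋙ verdierQ (thickModQuotient e f) ⋙ Φ ≅
        boundedMap (homFunctor he) ⋙ verdierQ (thickBiCorner f he)),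
      NatTrans.CommShift α.hom ℤ ∧ Φ.IsEquivalence := by
  let G := inducedFunctor he
  have : G.Additive := (inducedAdjunction he).left_adjoint_additive
  have : (boundedMap (homFunctor he)).IsLocalization (boundedMap (homFunctor he)).kernel.trW :=
    boundedMap_isLocalization (inducedAdjunction he)
  have e₁ (M : FGModuleCat.{u} Aᵐᵒᵖ) : (boundedMap (homFunctor he)).obj (stalk.obj M) ≅
      stalk.obj ((homFunctor he).obj M) :=
    ObjectProperty.isoMk _ (((homFunctor he).mapDerivedCategorySingleFunctor 0).app M)
  have e₂ : (boundedMap (homFunctor he)).obj (stalk.obj (FGModuleCat.of Aᵐᵒᵖ (rightIdeal f))) ≅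
      stalk.obj (FGModuleCat.of he.Cornerᵐᵒᵖ (BiCorner f he)) :=
    e₁ _ ≪≫ stalk.mapIso (cornerHomRightIdealEquiv f he).symm.toFGModuleCatIso
  refine exists_equivalence_verdierQuotient (boundedMap (homFunctor he)) stalk (modQuotient e)
    (.singleton (stalk.obj (FGModuleCat.of Aᵐᵒᵖ (rightIdeal f))))
    (.singleton (stalk.obj (FGModuleCat.of he.Cornerᵐᵒᵖ (BiCorner f he)))) ?_ ?_ ?_ ?_
  · intro M hM
    rw [← kernel_homFunctor he] at hM
    exact (e₁ M).isZero_iff.2 (IsZero.of_full_of_faithful_of_isZero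
      DerivedCategory.Bounded.ι _ ((DerivedCategory.singleFunctor _ 0).map_isZero hM))
  · rw [← kernel_homFunctor he]
    exact kernel_boundedMap_le_thick _
  · intro X hX
    rw [ObjectProperty.singleton_iff] at hX
    subst hX
    exact (thick _).prop_of_iso e₂.symm (le_thick _ _ (by simp))
  · intro Y hY
    rw [ObjectProperty.singleton_iff] at hY
    subst hY
    exact ⟨_, by simp, ⟨e₂⟩⟩
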